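/- Let $m\ge n$ be nonnegative integers, let $\bar A\in\mathbb R^{m\times n}$, $\bar b\in\mathbb R^m$, $\bar c\in\mathbb R^n$ satisfy $\|\bar A\|,\|\bar b\|,\|\bar c\|\le 1$, and let $0<\sigma\le 1$ and $\epsilon\ge 0$. Here $\|\cdot\|$ is the Euclidean norm of vectors and the corresponding operator norm of matrices. Let $A$, $b$, $c$ be independent, where $A$ is a Gaussian random matrix and $b$, $c$ are Gaussian random vectors, of variance $\sigma^2$ and centered at $\bar A$, $\bar b$, $\bar c$ respectively (that is, all entries are independent Gaussians of variance $\sigma^2$ whose means are the corresponding entries of $\bar A,\bar b,\bar c$). Consider the linear program $$\max\; c\,x\quad\text{such that } Ax\le b,\; x\ge 0,$$ and its dual $$\min\; y\,b\quad\text{such that } yA\ge c,\; y\ge 0.$$ Let $\mathcal F(A,b,c)$ be the event that the (primal) program is feasible and bounded. Let $x^*$ and $y^*$ be the optimal solutions of the primal and the dual program, which with probability $1$ exist and are unique when $\mathcal F(A,b,c)$ holds. Let $$\alpha_P(A,b,c)=\min_{i:\,x^*_i>0}x^*_i,\qquad \alpha_D(A,b,c)=\min_{j:\,y^*_j>0}y^*_j,$$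 where the minimum over the empty set is $+\infty$. Then $$\Pr\left[\alpha_P(A,b,c)\le\frac{\epsilon}{(\|A\|+2)^2(\|x^*\|+1)}\ \text{ and }\ \mathcal F(A,b,c)\right]\le\frac{8\epsilon n(m+1)}{\sigma^2},$$ and, likewise, $$\Pr\left[\alpha_D(A,b,c)\le\frac{\epsilon}{(\|A\|+2)^2(\|y^*\|+1)}\ \text{ and }\ \mathcal F(A,b,c)\right]\le\frac{8\epsilon n(m+1)}{\sigma^2}.$$ -/

import Mathlib

open MeasureTheory ProbabilityTheory
open scoped Matrix Matrix.Norms.L2Operator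

/-! The linear program specified by `(A, b, c)`:
maximize `c ⬝ᵥ x` subject to `A *ᵥ x ≤ b`, `0 ≤ x`, with dual
minimize `y ⬝ᵥ b` subject to `c ≤ y ᵥ* A`, `0 ≤ y`
(inequalities between vectors are coordinatewise). -/

namespace SmoothedLP

variable {m n : ℕ}

/-- The Euclidean norm of a vector (functions `Fin k → ℝ` carry the sup norm in Mathlib). -/
noncomputable def euclNorm {k : ℕ} (x : Fin k → ℝ) : ℝ := √(∑ i, x i ^ 2)

/-- The operator norm `max_{x ≠ 0} ‖A x‖ / ‖x‖` of a matrix with respect to Euclidean norms. -/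
noncomputable def opNorm (A : Matrix (Fin m) (Fin n) ℝ) : ℝ := ‖A‖

def PrimalFeasible (A : Matrix (Fin m) (Fin n) ℝ) (b : Fin m → ℝ) (x : Fin n → ℝ) : Prop :=
  A *ᵥ x ≤ b ∧ 0 ≤ x

def DualFeasible (A : Matrix (Fin m) (Fin n) ℝ) (c : Fin n → ℝ) (y : Fin m → ℝ) : Prop :=
  c ≤ y ᵥ* A ∧ 0 ≤ y

def IsPrimalOptimal (A : Matrix (Fin m) (Fin n) ℝ) (b : Fin m → ℝ) (c : Fin n → ℝ)
    (x : Fin n → ℝ) : Prop :=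
  PrimalFeasible A b x ∧ ∀ x', PrimalFeasible A b x' → c ⬝ᵥ x' ≤ c ⬝ᵥ x

def IsDualOptimal (A : Matrix (Fin m) (Fin n) ℝ) (b : Fin m → ℝ) (c : Fin n → ℝ)
    (y : Fin m → ℝ) : Prop :=
  DualFeasible A c y ∧ ∀ y', DualFeasible A c y' → y ⬝ᵥ b ≤ y' ⬝ᵥ b

/-- The linear program is feasible and bounded: there is a feasible point, and the objective is
bounded above on the set of feasible points. -/
def FeasibleBounded (A : Matrix (Fin m) (Fin n) ℝ) (b : Fin m → ℝ) (c : Fin n → ℝ) : Prop :=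
  (∃ x, PrimalFeasible A b x) ∧ BddAbove ((fun x => c ⬝ᵥ x) '' {x | PrimalFeasible A b x})

open Classical in
/-- The primal optimal solution `x*` (the zero vector if there is none). -/
noncomputable def xStar (A : Matrix (Fin m) (Fin n) ℝ) (b : Fin m → ℝ) (c : Fin n → ℝ) :
    Fin n → ℝ :=
  if h : ∃ x, IsPrimalOptimal A b c x then h.choose else 0

open Classical in
/-- The dual optimal solution `y*` (the zero vector if there is none). -/
noncomputable def yStar (A : Matrix (Fin m) (Fin n) ℝ) (b : Fin m → ℝ) (c : Fin n → ℝ) :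
    Fin m → ℝ :=
  if h : ∃ y, IsDualOptimal A b c y then h.choose else 0

/-- The index set `U` of the positive coordinates of `x*`. -/
def supportU (A : Matrix (Fin m) (Fin n) ℝ) (b : Fin m → ℝ) (c : Fin n → ℝ) : Set (Fin n) :=
  {i | 0 < xStar A b c i}

/-- The index set `V` of the positive coordinates of `y*`. -/
def supportV (A : Matrix (Fin m) (Fin n) ℝ) (b : Fin m → ℝ) (c : Fin n → ℝ) : Set (Fin m) :=
  {j | 0 < yStar A b c j}

/-- `α_P = min_{i ∈ U} x*_i`, the minimum of the empty set being `+∞`. -/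
noncomputable def alphaP (A : Matrix (Fin m) (Fin n) ℝ) (b : Fin m → ℝ) (c : Fin n → ℝ) : EReal :=
  ⨅ i ∈ supportU A b c, (xStar A b c i : EReal)

/-- `α_D = min_{j ∈ V} y*_j`, the minimum of the empty set being `+∞`. -/
noncomputable def alphaD (A : Matrix (Fin m) (Fin n) ℝ) (b : Fin m → ℝ) (c : Fin n → ℝ) : EReal :=
  ⨅ j ∈ supportV A b c, (yStar A b c j : EReal)

/-- The law of a Gaussian random vector of variance `σ²` centered at `v`: the coordinates are
independent Gaussians of variance `σ²` with means `v i`. -/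
noncomputable def gaussianVec {k : ℕ} (v : Fin k → ℝ) (σ : ℝ) : Measure (Fin k → ℝ) :=
  Measure.pi fun i => gaussianReal (v i) (σ ^ 2).toNNReal

/-- The law of a Gaussian random matrix of variance `σ²` centered at `M` (independent entries),
as an array of entries. -/
noncomputable def gaussianMat (M : Fin m → Fin n → ℝ) (σ : ℝ) :
    Measure (Fin m → Fin n → ℝ) :=
  Measure.pi fun j => gaussianVec (M j) σ

/-- The joint law of independent Gaussian `A`, `b`, `c` of variance `σ²` centered at
`A₀`, `b₀`, `c₀`. -/
noncomputable def gaussianLP (A₀ : Matrix (Fin m) (Fin n) ℝ) (b₀ : Fin m → ℝ) (c₀ : Fin n → ℝ)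
    (σ : ℝ) : Measure ((Fin m → Fin n → ℝ) × (Fin m → ℝ) × (Fin n → ℝ)) :=
  (gaussianMat A₀ σ).prod ((gaussianVec b₀ σ).prod (gaussianVec c₀ σ))

end SmoothedLP

/-! Fix `A`; the randomness of `b` and `c` suffices. If `x` is optimal for `b` and `x i > 0`, then
for `t ≥ 0` the point `x + t e_i` is optimal for `b + t A_i`, where `A_i` is the `i`-th column
(`IsPrimalOptimal.add_single`). So along a line in direction `A_i` a positive optimal coordinate
grows at unit speed, and it stays in `(0, δ]` only for a parameter set of length at most `δ`. Since
`‖A_i‖ ≤ M = ‖A‖ + 2`, such a set has Gaussian measure at most `3Mδ/σ` (`gaussianVec_le_of_lines`).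
For `δ = ε/M²` this is `3ε/(Mσ) ≤ 3ε/(2σ)`, and a union bound over coordinates finishes the primal
case.

The argument needs the `i`-th coordinate to be the same for all optima. This holds for almost every
`c`: the coordinate is monotone along `c + s e_i`, so it is ambiguous for only countably many `s`.

The dual is the primal program with data `(-Aᵀ, -c, -b)`. As `xStar` and `yStar` are arbitrary
choices, their events are enclosed in Borel sets that quantify over all optima. -/

namespace SmoothedLP

/-! ### Gaussian measure of sets that are thin along parallel lines -/

/-- A Gaussian vector has the product of the coordinate densities as its Lebesgue density. -/
lemma gaussianVec_eq_withDensity {k : ℕ} (v : Fin k → ℝ) {σ : ℝ} (hσ : 0 < σ) :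
    gaussianVec v σ = (volume : Measure (Fin k → ℝ)).withDensity
      fun b => ENNReal.ofReal (∏ i, gaussianPDFReal (v i) (σ ^ 2).toNNReal (b i)) := by
  have hv : (σ ^ 2).toNNReal ≠ 0 := by
    rw [Ne, Real.toNNReal_eq_zero, not_le]; positivity
  refine Measure.pi_eq fun s hs => ?_
  rw [withDensity_apply _ (MeasurableSet.univ_pi hs), volume_pi, Measure.restrict_pi_pi]
  have hint : ∀ i, Integrable (gaussianPDFReal (v i) (σ ^ 2).toNNReal) (volume.restrict (s i)) :=
    fun i => (integrable_gaussianPDFReal _ _).restrict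
  rw [← ofReal_integral_eq_lintegral_ofReal (Integrable.fintype_prod hint)
    (Filter.Eventually.of_forall fun b =>
      Finset.prod_nonneg fun i _ => gaussianPDFReal_nonneg _ _ _),
    integral_fintype_prod_eq_prod, ENNReal.ofReal_prod_of_nonneg fun i _ =>
      integral_nonneg fun x => gaussianPDFReal_nonneg _ _ _]
  refine Finset.prod_congr rfl fun i _ => ?_
  rw [gaussianReal_of_var_ne_zero _ hv, withDensity_apply _ (hs i),
    ofReal_integral_eq_lintegral_ofReal (hint i)
      (Filter.Eventually.of_forall fun x => gaussianPDFReal_nonneg _ _ _)]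
  rfl

lemma prod_gaussianPDFReal {k : ℕ} (v : Fin k → ℝ) (σ : ℝ) (b : Fin k → ℝ) :
    ∏ i, gaussianPDFReal (v i) (σ ^ 2).toNNReal (b i) =
      (√(2 * Real.pi * σ ^ 2))⁻¹ ^ k * Real.exp (-(∑ i, (b i - v i) ^ 2) / (2 * σ ^ 2)) := by
  simp only [gaussianPDFReal, Finset.prod_mul_distrib, Finset.prod_const, Finset.card_univ,
    Fintype.card_fin, ← Real.exp_sum, Real.coe_toNNReal _ (sq_nonneg σ)]
  rw [← Finset.sum_div, Finset.sum_neg_distrib]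

/-- Along a segment of length `σ / M` in a direction of norm at most `M`, the Gaussian density is
bounded by its values at the two ends. -/
lemma gaussian_density_segment {k : ℕ} (v a : Fin k → ℝ) {σ M : ℝ} (hσ : 0 < σ) (hM : 0 < M)
    (ha : ∑ i, a i ^ 2 ≤ M ^ 2) (b : Fin k → ℝ) {t : ℝ} (ht : t ∈ Set.Icc 0 (σ / M)) :
    ∏ i, gaussianPDFReal (v i) (σ ^ 2).toNNReal ((b + t • a) i) ≤
      ∏ i, gaussianPDFReal (v i) (σ ^ 2).toNNReal (b i) +
        2 * ∏ i, gaussianPDFReal (v i) (σ ^ 2).toNNReal ((b + (σ / M) • a) i) := by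
  simp only [prod_gaussianPDFReal]
  set L := σ / M with hL
  set K := (√(2 * Real.pi * σ ^ 2))⁻¹ ^ k
  have hK : 0 ≤ K := by positivity
  have hQ : ∀ s : ℝ, ∑ i, ((b + s • a) i - v i) ^ 2 =
      ∑ i, (b i - v i) ^ 2 + 2 * s * ∑ i, a i * (b i - v i) + s ^ 2 * ∑ i, a i ^ 2 := by
    intro s
    simp only [Finset.mul_sum, ← Finset.sum_add_distrib]
    refine Finset.sum_congr rfl fun i _ => ?_
    simp only [Pi.add_apply, Pi.smul_apply, smul_eq_mul]; ring
  rw [hQ t, hQ L]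
  set q := ∑ i, a i ^ 2
  set B := ∑ i, a i * (b i - v i)
  set Q := ∑ i, (b i - v i) ^ 2
  have hq : 0 ≤ q := Finset.sum_nonneg fun i _ => sq_nonneg _
  have hLq : L ^ 2 * q ≤ σ ^ 2 := by
    calc L ^ 2 * q ≤ L ^ 2 * M ^ 2 := by gcongr
      _ = σ ^ 2 := by rw [hL]; field_simp
  -- The squared distance to `v` is `Q + 2sB + s²q`. If `B ≥ 0`, it is least at `s = 0`. If `B ≤ 0`,
  -- passing from `t` to `L` raises it by at most `L²q ≤ σ²`, which costs a factor `exp (1/2) ≤ 2`.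
  rcases le_total 0 B with hB | hB
  · have : Real.exp (-(Q + 2 * t * B + t ^ 2 * q) / (2 * σ ^ 2)) ≤
        Real.exp (-Q / (2 * σ ^ 2)) := by
      have := ht.1
      gcongr
      nlinarith [mul_nonneg this hB, mul_nonneg (sq_nonneg t) hq]
    have h1 := mul_le_mul_of_nonneg_left this hK
    have h2 : 0 ≤ K * Real.exp (-(Q + 2 * L * B + L ^ 2 * q) / (2 * σ ^ 2)) := by positivity
    linarith
  · have : Real.exp (-(Q + 2 * t * B + t ^ 2 * q) / (2 * σ ^ 2)) ≤
        2 * Real.exp (-(Q + 2 * L * B + L ^ 2 * q) / (2 * σ ^ 2)) := by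
      have h2 : Real.exp (1 / 2) ≤ 2 := by
        rw [← Real.le_log_iff_exp_le two_pos]
        linarith [Real.log_two_gt_d9]
      calc _ ≤ Real.exp (1 / 2 + -(Q + 2 * L * B + L ^ 2 * q) / (2 * σ ^ 2)) := by
            gcongr
            rw [div_add_div _ _ (by norm_num) (by positivity), div_le_div_iff₀ (by positivity)
              (by positivity)]
            have h3 : -(Q + 2 * t * B + t ^ 2 * q) ≤ σ ^ 2 - (Q + 2 * L * B + L ^ 2 * q) := by
              nlinarith [mul_nonneg (sub_nonneg.2 ht.2) (neg_nonneg.2 hB),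
                mul_nonneg (sq_nonneg t) hq]
            have : 0 < σ ^ 2 := by positivity
            nlinarith
        _ ≤ _ := by rw [Real.exp_add]; gcongr
    have h1 := mul_le_mul_of_nonneg_left this hK
    have h2 : 0 ≤ K * Real.exp (-Q / (2 * σ ^ 2)) := by positivity
    linarith

/-- If every line in direction `a` meets `S` in a set of length at most `δ`, then `S` has small
Gaussian measure. -/
lemma gaussianVec_le_of_lines {k : ℕ} (v a : Fin k → ℝ) {σ M : ℝ} (hσ : 0 < σ) (hM : 0 < M)
    (ha : ∑ i, a i ^ 2 ≤ M ^ 2) {S : Set (Fin k → ℝ)} (hS : MeasurableSet S) {δ : ENNReal}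
    (hline : ∀ b, volume {t : ℝ | b + t • a ∈ S} ≤ δ) :
    gaussianVec v σ S ≤ ENNReal.ofReal (3 * M / σ) * δ := by
  set F : (Fin k → ℝ) → ENNReal := fun b =>
    ENNReal.ofReal (∏ i, gaussianPDFReal (v i) (σ ^ 2).toNNReal (b i)) with hF
  have hFm : Measurable F := by
    refine ENNReal.measurable_ofReal.comp (Finset.measurable_prod _ fun i _ => ?_)
    exact (measurable_gaussianPDFReal _ _).comp (measurable_pi_apply i)
  have hden := gaussianVec_eq_withDensity v hσ
  have hF1 : ∫⁻ b, F b = 1 := by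
    have : IsProbabilityMeasure (gaussianVec v σ) := by unfold gaussianVec; infer_instance
    have h := measure_univ (μ := gaussianVec v σ)
    rwa [hden, withDensity_apply _ MeasurableSet.univ, Measure.restrict_univ] at h
  set L := σ / M with hL
  have hLpos : 0 < L := by positivity
  have hFS : gaussianVec v σ S = ∫⁻ b, S.indicator F b := by
    rw [hden, withDensity_apply _ hS, lintegral_indicator hS]
  have hshift : ∀ t : ℝ, ∫⁻ b, S.indicator F (b + t • a) = gaussianVec v σ S := by
    intro t
    rw [hFS, lintegral_add_right_eq_self]
  have hmeas : Measurable fun p : ℝ × (Fin k → ℝ) => p.2 + p.1 • a := by fun_prop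
  -- Average over shifts `t ∈ [0, L]`, bound the density by the two ends, and integrate in `t`
  -- first: each line contributes at most `δ`, and the ends have total mass `1 + 2`.
  have key : ENNReal.ofReal L * gaussianVec v σ S ≤ 3 * δ := by
    calc ENNReal.ofReal L * gaussianVec v σ S
        = ∫⁻ t in Set.Icc 0 L, ∫⁻ b, S.indicator F (b + t • a) := by
          simp only [hshift, lintegral_const, Measure.restrict_apply MeasurableSet.univ,
            Set.univ_inter, Real.volume_Icc, sub_zero]
          rw [mul_comm]
      _ ≤ ∫⁻ t in Set.Icc 0 L, ∫⁻ b, S.indicator 1 (b + t • a) * (F b + 2 * F (b + L • a)) := by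
          refine setLIntegral_mono' measurableSet_Icc fun t ht => lintegral_mono fun b => ?_
          by_cases hb : b + t • a ∈ S
          · simp only [Set.indicator_of_mem hb, Pi.one_apply, one_mul, hF]
            rw [← ENNReal.ofReal_ofNat, ← ENNReal.ofReal_mul (by norm_num), ← ENNReal.ofReal_add]
            · exact ENNReal.ofReal_le_ofReal (gaussian_density_segment v a hσ hM ha b ht)
            · exact Finset.prod_nonneg fun i _ => gaussianPDFReal_nonneg _ _ _
            · exact mul_nonneg (by norm_num)
                (Finset.prod_nonneg fun i _ => gaussianPDFReal_nonneg _ _ _)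
          · simp [Set.indicator_of_notMem hb]
      _ = ∫⁻ b, ∫⁻ t in Set.Icc 0 L, S.indicator 1 (b + t • a) * (F b + 2 * F (b + L • a)) := by
          refine lintegral_lintegral_swap (Measurable.aemeasurable ?_)
          refine Measurable.mul ((measurable_one.indicator hS).comp hmeas) ?_
          fun_prop
      _ ≤ ∫⁻ b, δ * (F b + 2 * F (b + L • a)) := by
          refine lintegral_mono fun b => ?_
          have hm : MeasurableSet {t : ℝ | b + t • a ∈ S} :=
            hS.preimage (by fun_prop : Measurable fun t : ℝ => b + t • a)
          have hi : (fun t : ℝ => S.indicator (1 : (Fin k → ℝ) → ENNReal) (b + t • a)) =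
              {t : ℝ | b + t • a ∈ S}.indicator 1 := rfl
          rw [lintegral_mul_const _ (by rw [hi]; exact measurable_one.indicator hm), hi,
            lintegral_indicator_one hm]
          gcongr
          exact (Measure.restrict_apply_le _ _).trans (hline b)
      _ = 3 * δ := by
          rw [lintegral_const_mul _ (by fun_prop), lintegral_add_left hFm,
            lintegral_const_mul _ (by fun_prop), lintegral_add_right_eq_self F, hF1, mul_comm]
          norm_num
  have hc : ENNReal.ofReal (3 * M / σ) = 3 * (ENNReal.ofReal L)⁻¹ := by
    rw [← ENNReal.ofReal_inv_of_pos hLpos, ← ENNReal.ofReal_ofNat,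
      ← ENNReal.ofReal_mul (by norm_num), hL]
    congr 1
    field_simp
  rw [hc, mul_right_comm, mul_comm]
  rwa [← ENNReal.mul_le_iff_le_inv (by simpa using hLpos) ENNReal.ofReal_ne_top]

/-- The Gaussian law of a reflected vector. -/
lemma gaussianVec_map_neg {k : ℕ} (v : Fin k → ℝ) (σ : ℝ) :
    MeasurePreserving (fun b : Fin k → ℝ => -b) (gaussianVec v σ) (gaussianVec (-v) σ) := by
  refine measurePreserving_pi _ _ fun i => ⟨measurable_neg, gaussianReal_map_neg⟩

variable {m n : ℕ}

/-! ### Measurability of events about optimal solutions -/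

/-- The projection along a finite-dimensional factor of a closed set is Borel. -/
lemma measurableSet_exists_of_isClosed {X Y : Type*} [TopologicalSpace X] [TopologicalSpace Y]
    [SigmaCompactSpace X] [SigmaCompactSpace Y] [T2Space X] [MeasurableSpace X]
    [OpensMeasurableSpace X] {C : Set (X × Y)} (hC : IsClosed C) :
    MeasurableSet {x | ∃ y, (x, y) ∈ C} := by
  obtain ⟨K, hK, hKC⟩ := (isSigmaCompact_univ.of_isClosed_subset hC
    (Set.subset_univ C)).image continuous_fst
  have : {x | ∃ y, (x, y) ∈ C} = ⋃ i, K i := by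
    rw [hKC]; ext x; simp
  rw [this]
  exact MeasurableSet.iUnion fun i => (hK i).measurableSet

/-- The space of data `(A, b, c)` of linear programs. -/
abbrev Data (m n : ℕ) : Type := (Fin m → Fin n → ℝ) × (Fin m → ℝ) × (Fin n → ℝ)

/-- `x` is an optimal solution of the linear program `p`. -/
abbrev Opt (p : Data m n) (x : Fin n → ℝ) : Prop :=
  IsPrimalOptimal (Matrix.of p.1) p.2.1 p.2.2 x

lemma isClosed_feasible :
    IsClosed {q : Data m n × (Fin n → ℝ) | PrimalFeasible (Matrix.of q.1.1) q.1.2.1 q.2} := by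
  have hmul : Continuous fun q : Data m n × (Fin n → ℝ) => Matrix.of q.1.1 *ᵥ q.2 := by
    refine continuous_pi fun i => ?_
    simp only [Matrix.mulVec, dotProduct, Matrix.of_apply]
    fun_prop
  have h1 : IsClosed {q : Data m n × (Fin n → ℝ) | Matrix.of q.1.1 *ᵥ q.2 ≤ q.1.2.1} :=
    isClosed_le hmul (by fun_prop)
  have h2 : IsClosed {q : Data m n × (Fin n → ℝ) | 0 ≤ q.2} :=
    isClosed_le continuous_const continuous_snd
  exact h1.inter h2

lemma continuous_objective : Continuous fun q : Data m n × (Fin n → ℝ) => q.1.2.2 ⬝ᵥ q.2 := by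
  simp only [dotProduct]
  fun_prop

/-- For a closed set `C` of pairs, the set of linear programs with an optimal solution in `C` is
Borel. -/
lemma measurableSet_exists_opt {C : Set (Data m n × (Fin n → ℝ))} (hC : IsClosed C) :
    MeasurableSet {p : Data m n | ∃ x, Opt p x ∧ (p, x) ∈ C} := by
  set G := {q : Data m n × (Fin n → ℝ) | PrimalFeasible (Matrix.of q.1.1) q.1.2.1 q.2}
  have hG : IsClosed G := isClosed_feasible
  set D : ℕ → Set (Data m n × (Fin n → ℝ)) := fun R => G ∩ C ∩ {q | q.2 ∈ Metric.closedBall 0 R}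
  have hD : ∀ R, IsClosed (D R) := fun R =>
    (hG.inter hC).inter (Metric.isClosed_closedBall.preimage continuous_snd)
  have hge : ∀ r : ℚ, IsClosed {q : Data m n × (Fin n → ℝ) | (r : ℝ) ≤ q.1.2.2 ⬝ᵥ q.2} :=
    fun r => isClosed_le continuous_const continuous_objective
  -- Some optimum lies in `C` and in the ball of radius `R` iff the compact slice of `D R` is
  -- nonempty and reaches every rational level that feasible points reach; its maximizer is then a
  -- global one.
  have heq : {p : Data m n | ∃ x, Opt p x ∧ (p, x) ∈ C} =
      ⋃ R : ℕ, {p | ∃ x, (p, x) ∈ D R} ∩ ⋂ r : ℚ,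
        ({p : Data m n | ∃ x, (p, x) ∈ G ∩ {q | (r : ℝ) ≤ q.1.2.2 ⬝ᵥ q.2}}ᶜ ∪
          {p | ∃ x, (p, x) ∈ D R ∩ {q | (r : ℝ) ≤ q.1.2.2 ⬝ᵥ q.2}}) := by
    ext p
    simp only [Set.mem_iUnion, Set.mem_inter_iff, Set.mem_iInter, Set.mem_union, Set.mem_compl_iff]
    constructor
    · rintro ⟨x, hx, hxC⟩
      obtain ⟨R, hR⟩ := exists_nat_ge ‖x‖
      have hxD : (p, x) ∈ D R := ⟨⟨hx.1, hxC⟩, by simpa using hR⟩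
      refine ⟨R, ⟨x, hxD⟩, fun r => ?_⟩
      by_cases h : ∃ x', (p, x') ∈ G ∩ {q | (r : ℝ) ≤ q.1.2.2 ⬝ᵥ q.2}
      · obtain ⟨x', hx', hr⟩ := h
        exact Or.inr ⟨x, hxD, le_trans hr (hx.2 x' hx')⟩
      · exact Or.inl h
    · rintro ⟨R, hne, hr⟩
      have hcomp : IsCompact {x | (p, x) ∈ D R} := by
        refine (isCompact_closedBall (0 : Fin n → ℝ) R).of_isClosed_subset
          ((hD R).preimage (by fun_prop : Continuous fun x => (p, x))) fun x hx => hx.2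
      obtain ⟨x, hx, hmax⟩ := hcomp.exists_isMaxOn hne
        ((continuous_objective.comp (by fun_prop : Continuous fun x => (p, x))).continuousOn)
      refine ⟨x, ⟨hx.1.1, fun x' hx' => ?_⟩, hx.1.2⟩
      by_contra! hlt
      obtain ⟨r, h1, h2⟩ := exists_rat_btwn hlt
      rcases hr r with h | ⟨z, hz, hzr⟩
      · exact h ⟨x', hx', h2.le⟩
      · exact absurd (hmax hz) (not_le.2 (lt_of_lt_of_le h1 hzr))
  rw [heq]
  refine MeasurableSet.iUnion fun R => (measurableSet_exists_of_isClosed (hD R)).inter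
    (MeasurableSet.iInter fun r => ?_)
  exact (measurableSet_exists_of_isClosed (hG.inter (hge r))).compl.union
    (measurableSet_exists_of_isClosed ((hD R).inter (hge r)))

lemma continuous_opNorm : Continuous fun A : Fin m → Fin n → ℝ => opNorm (Matrix.of A) :=
  continuous_norm (E := Matrix (Fin m) (Fin n) ℝ)

/-- The linear programs having an optimal solution whose `i`-th coordinate is positive and at most
`ε / (‖A‖ + 2)²`. -/
def smallCoord (m : ℕ) {n : ℕ} (ε : ℝ) (i : Fin n) : Set (Data m n) :=
  {p | ∃ x, Opt p x ∧ 0 < x i ∧ x i ≤ ε / (opNorm (Matrix.of p.1) + 2) ^ 2}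

lemma opNorm_nonneg (A : Matrix (Fin m) (Fin n) ℝ) : 0 ≤ opNorm A := norm_nonneg A

lemma measurableSet_smallCoord (ε : ℝ) (i : Fin n) : MeasurableSet (smallCoord m ε i) := by
  have hδ : Continuous fun q : Data m n × (Fin n → ℝ) =>
      ε / (opNorm (Matrix.of q.1.1) + 2) ^ 2 := by
    refine continuous_const.div₀ ?_ fun q => ?_
    · exact ((continuous_opNorm.comp (by fun_prop)).add continuous_const).pow 2
    · have := opNorm_nonneg (Matrix.of q.1.1)
      positivity
  have heq : smallCoord m ε i = ⋃ k : ℕ, {p | ∃ x, Opt p x ∧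
      (p, x) ∈ {q : Data m n × (Fin n → ℝ) | 1 / ((k : ℝ) + 1) ≤ q.2 i} ∩
        {q | q.2 i ≤ ε / (opNorm (Matrix.of q.1.1) + 2) ^ 2}} := by
    ext p
    simp only [smallCoord, Set.mem_iUnion, Set.mem_ofPred_eq, Set.mem_inter_iff]
    constructor
    · rintro ⟨x, hx, h0, h1⟩
      obtain ⟨k, hk⟩ := exists_nat_one_div_lt h0
      exact ⟨k, x, hx, hk.le, h1⟩
    · rintro ⟨k, x, hx, h0, h1⟩
      exact ⟨x, hx, lt_of_lt_of_le (by positivity) h0, h1⟩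
  rw [heq]
  exact MeasurableSet.iUnion fun k => measurableSet_exists_opt
    ((isClosed_le (by fun_prop) (by fun_prop)).inter (isClosed_le (by fun_prop) hδ))

/-- The linear programs whose optimal solutions do not all have the same `i`-th coordinate. -/
def ambiguousCoord (m : ℕ) {n : ℕ} (i : Fin n) : Set (Data m n) :=
  {p | ∃ x x', Opt p x ∧ Opt p x' ∧ x i < x' i}

lemma measurableSet_ambiguousCoord (i : Fin n) : MeasurableSet (ambiguousCoord m i) := by
  have heq : ambiguousCoord m i = ⋃ r : ℚ, ⋃ s : ℚ, ⋃ _ : r < s,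
      ({p | ∃ x, Opt p x ∧ (p, x) ∈ {q : Data m n × (Fin n → ℝ) | q.2 i ≤ r}} ∩
        {p | ∃ x, Opt p x ∧ (p, x) ∈ {q : Data m n × (Fin n → ℝ) | s ≤ q.2 i}}) := by
    ext p
    simp only [ambiguousCoord, Set.mem_iUnion, Set.mem_ofPred_eq, Set.mem_inter_iff]
    constructor
    · rintro ⟨x, x', hx, hx', h⟩
      obtain ⟨r, h1, h2⟩ := exists_rat_btwn h
      obtain ⟨s, h3, h4⟩ := exists_rat_btwn h2
      exact ⟨r, s, by exact_mod_cast h3, ⟨x, hx, h1.le⟩, x', hx', h4.le⟩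
    · rintro ⟨r, s, hrs, ⟨x, hx, h1⟩, x', hx', h2⟩
      exact ⟨x, x', hx, hx', h1.trans_lt (lt_of_lt_of_le (by exact_mod_cast hrs) h2)⟩
  rw [heq]
  refine MeasurableSet.iUnion fun r => MeasurableSet.iUnion fun s => MeasurableSet.iUnion fun _ =>
    (measurableSet_exists_opt ?_).inter (measurableSet_exists_opt ?_)
  · exact isClosed_le (by fun_prop) (by fun_prop)
  · exact isClosed_le (by fun_prop) (by fun_prop)

/-! ### Sensitivity of optimal solutions to `c` and `b` -/

/-- Increasing the `i`-th cost coefficient does not decrease the `i`-th coordinate of optimal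
solutions. -/
lemma opt_coord_mono {A : Matrix (Fin m) (Fin n) ℝ} {b : Fin m → ℝ} {c : Fin n → ℝ} {i : Fin n}
    {s t : ℝ} (hst : s < t) {x x' : Fin n → ℝ}
    (hx : IsPrimalOptimal A b (c + s • Pi.single i 1) x)
    (hx' : IsPrimalOptimal A b (c + t • Pi.single i 1) x') : x i ≤ x' i := by
  -- Adding the two optimality inequalities leaves `(t - s) * (x i - x' i) ≤ 0`.
  have h1 := hx.2 x' hx'.1
  have h2 := hx'.2 x hx.1
  simp only [add_dotProduct, smul_dotProduct, single_dotProduct, one_mul, smul_eq_mul] at h1 h2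
  nlinarith

/-- Moving `b` along the `i`-th column of `A` moves an optimal solution with positive `i`-th
coordinate along the `i`-th axis. -/
lemma IsPrimalOptimal.add_single {A : Matrix (Fin m) (Fin n) ℝ} {b : Fin m → ℝ} {c : Fin n → ℝ}
    {i : Fin n} {x : Fin n → ℝ} (hx : IsPrimalOptimal A b c x) (hpos : 0 < x i) {t : ℝ}
    (ht : 0 ≤ t) : IsPrimalOptimal A (b + t • A.col i) c (x + t • Pi.single i 1) := by
  have hcol : ∀ r : ℝ, A *ᵥ (r • Pi.single i 1) = r • A.col i := fun r => by
    rw [Matrix.mulVec_smul, Matrix.mulVec_single_one]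
  refine ⟨⟨?_, ?_⟩, fun x' hx' => ?_⟩
  · rw [Matrix.mulVec_add, hcol]
    exact add_le_add_left hx.1.1 _
  · exact add_nonneg hx.1.2 (smul_nonneg ht (Pi.single_nonneg.2 zero_le_one))
  -- A step of size `s` from `x` along `x' - (x + t e_i)` is feasible for the old `b`, so this
  -- direction cannot improve the objective. Only nonnegativity at `i` limits `s`; it is here that
  -- `x i > 0` allows `s > 0`.
  · obtain ⟨s, hs0, hs1, hsx⟩ : ∃ s : ℝ, 0 < s ∧ s ≤ 1 ∧ s * t ≤ x i * (1 - s) := by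
      refine ⟨x i / (x i + t), by positivity, div_le_one_of_le₀ (by linarith) (by linarith), ?_⟩
      have : x i + t ≠ 0 := by positivity
      field_simp
      linarith
    have hfeas : PrimalFeasible A b (x + s • (x' - (x + t • Pi.single i 1))) := by
      constructor
      · have h1 := hx.1.1
        have h2 := hx'.1
        intro j
        have h1j := h1 j
        have h2j := h2 j
        simp only [Matrix.mulVec_add, Matrix.mulVec_smul, Matrix.mulVec_sub,
          Matrix.mulVec_single_one, Pi.add_apply, Pi.smul_apply, Pi.sub_apply,
          smul_eq_mul] at h1j h2j ⊢
        nlinarith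
      · intro j
        have h1j := hx.1.2 j
        have h2j := hx'.2 j
        simp only [Pi.zero_apply, Pi.add_apply, Pi.smul_apply, Pi.sub_apply, smul_eq_mul]
          at h1j h2j ⊢
        rcases eq_or_ne j i with rfl | hj
        · simp only [Pi.single_eq_same, mul_one]
          nlinarith [mul_nonneg hs0.le h2j]
        · simp only [Pi.single_eq_of_ne hj, mul_zero, add_zero]
          nlinarith [mul_nonneg hs0.le h2j]
    have := hx.2 _ hfeas
    rw [dotProduct_add, dotProduct_smul, dotProduct_sub, smul_eq_mul] at this
    nlinarith

/-- A column is the image of a unit vector, so its norm is at most `‖A‖`. -/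
lemma sum_col_sq_le (A : Matrix (Fin m) (Fin n) ℝ) (i : Fin n) :
    ∑ j, A.col i j ^ 2 ≤ (opNorm A + 2) ^ 2 := by
  have h := A.l2_opNorm_mulVec (EuclideanSpace.single i (1 : ℝ))
  have h1 : (EuclideanSpace.equiv (Fin m) ℝ).symm
      (A *ᵥ (EuclideanSpace.single i (1 : ℝ) : EuclideanSpace ℝ (Fin n))) =
      WithLp.toLp 2 (A.col i) := by
    rw [EuclideanSpace.single]
    simp
  rw [h1, PiLp.norm_single, norm_one, mul_one, EuclideanSpace.norm_eq] at h
  simp only [Real.norm_eq_abs, sq_abs] at h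
  have h0 := opNorm_nonneg A
  have h2 := (Real.sqrt_le_left h0).1 h
  nlinarith

/-! ### Probability bounds for fixed `A` -/

instance {k : ℕ} (v : Fin k → ℝ) (σ : ℝ) : IsProbabilityMeasure (gaussianVec v σ) := by
  unfold gaussianVec; infer_instance

instance isProbabilityMeasure_gaussianMat (M : Fin m → Fin n → ℝ) (σ : ℝ) : IsProbabilityMeasure (gaussianMat M σ) := by
  unfold gaussianMat; infer_instance

/-- By `opt_coord_mono`, the open intervals between two differing optimal coordinates are disjoint
for different `s`, and the line holds only countably many such intervals. -/
lemma countable_ambiguous_line (A : Fin m → Fin n → ℝ) (b : Fin m → ℝ) (c : Fin n → ℝ)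
    (i : Fin n) : {s : ℝ | (A, b, c + s • Pi.single i 1) ∈ ambiguousCoord m i}.Countable := by
  set T := {s : ℝ | (A, b, c + s • Pi.single i 1) ∈ ambiguousCoord m i}
  have h : ∀ s : T, ∃ x x', Opt (A, b, c + s.1 • Pi.single i 1) x ∧
      Opt (A, b, c + s.1 • Pi.single i 1) x' ∧ x i < x' i := fun s => s.2
  choose x x' hx hx' hlt using h
  have hdisj : (Set.univ : Set T).PairwiseDisjoint fun s => Set.Ioo (x s i) (x' s i) := by
    have : ∀ s t : T, s.1 < t.1 → Disjoint (Set.Ioo (x s i) (x' s i)) (Set.Ioo (x t i) (x' t i)) :=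
      fun s t hst => Set.disjoint_left.2 fun u hu hu' =>
        absurd (hu.2.trans_le (opt_coord_mono hst (hx' s) (hx t))) (not_lt.2 hu'.1.le)
    intro s _ t _ hne
    rcases lt_or_gt_of_ne (Subtype.coe_injective.ne hne) with hst | hst
    · exact this s t hst
    · exact (this t s hst).symm
  have := hdisj.countable_of_isOpen (fun s _ => isOpen_Ioo) fun s _ => Set.nonempty_Ioo.2 (hlt s)
  exact Set.countable_coe_iff.1 (Set.countable_univ_iff.1 this)

/-- For fixed `A`, almost surely all optimal solutions have the same `i`-th coordinate. -/
lemma gaussian_ambiguousCoord (A : Fin m → Fin n → ℝ) (b₀ : Fin m → ℝ) (c₀ : Fin n → ℝ) {σ : ℝ}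
    (hσ : 0 < σ) (i : Fin n) :
    (gaussianVec b₀ σ).prod (gaussianVec c₀ σ) {q | (A, q) ∈ ambiguousCoord m i} = 0 := by
  have hm := measurableSet_ambiguousCoord (m := m) i
  change (gaussianVec b₀ σ).prod (gaussianVec c₀ σ) (Prod.mk A ⁻¹' ambiguousCoord m i) = 0
  rw [Measure.measure_prod_null (hm.preimage measurable_prodMk_left)]
  refine Filter.Eventually.of_forall fun b => ?_
  have := gaussianVec_le_of_lines c₀ (Pi.single i 1) hσ one_pos
    (S := {c | (A, b, c) ∈ ambiguousCoord m i}) (δ := 0) (by simp [Pi.single_apply])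
    (hm.preimage (by fun_prop : Measurable fun c : Fin n → ℝ => (A, b, c)))
    (fun c => ((countable_ambiguous_line A b c i).measure_zero volume).le)
  rw [mul_zero] at this
  exact le_antisymm this zero_le

/-- For fixed `A`, the `i`-th coordinate of an optimal solution is unlikely to be small. -/
lemma gaussian_smallCoord_le (A : Fin m → Fin n → ℝ) (b₀ : Fin m → ℝ) (c₀ : Fin n → ℝ) {σ ε : ℝ}
    (hσ : 0 < σ) (hε : 0 ≤ ε) (i : Fin n) :
    (gaussianVec b₀ σ).prod (gaussianVec c₀ σ) {q | (A, q) ∈ smallCoord m ε i} ≤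
      ENNReal.ofReal (3 * ε / (2 * σ)) := by
  have hN := measurableSet_ambiguousCoord (m := m) i
  have hS := measurableSet_smallCoord (m := m) ε i
  set M := opNorm (Matrix.of A) + 2 with hM
  have hM2 : 2 ≤ M := by linarith [opNorm_nonneg (Matrix.of A)]
  have hsub : {q | (A, q) ∈ smallCoord m ε i} ⊆
      {q | (A, q) ∈ smallCoord m ε i \ ambiguousCoord m i} ∪
        {q | (A, q) ∈ ambiguousCoord m i} := fun q hq =>
    (em ((A, q) ∈ ambiguousCoord m i)).elim Or.inr fun h => Or.inl ⟨hq, h⟩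
  refine (measure_mono hsub).trans ((measure_union_le _ _).trans ?_)
  rw [gaussian_ambiguousCoord A b₀ c₀ hσ i, add_zero]
  change (gaussianVec b₀ σ).prod (gaussianVec c₀ σ)
    (Prod.mk A ⁻¹' (smallCoord m ε i \ ambiguousCoord m i)) ≤ _
  rw [Measure.prod_apply_symm ((hS.diff hN).preimage measurable_prodMk_left)]
  refine (lintegral_mono (g := fun _ => ENNReal.ofReal (3 * ε / (2 * σ))) fun c => ?_).trans
    (by simp)
  have hline := gaussianVec_le_of_lines b₀ (Matrix.col (Matrix.of A) i) hσ (M := M) (by linarith)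
    (sum_col_sq_le _ i) (S := {b | (A, b, c) ∈ smallCoord m ε i \ ambiguousCoord m i})
    (δ := ENNReal.ofReal (ε / M ^ 2))
    ((hS.diff hN).preimage (by fun_prop : Measurable fun b : Fin m → ℝ => (A, b, c))) ?_
  · refine hline.trans ?_
    rw [← ENNReal.ofReal_mul (by positivity)]
    refine ENNReal.ofReal_le_ofReal ?_
    have : 3 * M / σ * (ε / M ^ 2) = 3 * ε / (M * σ) := by field_simp
    rw [this]
    gcongr
  · intro b
    refine (Real.volume_le_diam _).trans (Metric.ediam_le fun s hs t ht => ?_)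
    -- The optimum at `s`, moved by `t - s`, is optimal at `t` with `i`-th coordinate above `t - s`.
    -- Unambiguity at `t` carries the upper bound on `x' i` over to it.
    have key : ∀ s t : ℝ, s ≤ t →
        (A, b + s • Matrix.col (Matrix.of A) i, c) ∈ smallCoord m ε i \ ambiguousCoord m i →
        (A, b + t • Matrix.col (Matrix.of A) i, c) ∈ smallCoord m ε i \ ambiguousCoord m i →
        t - s ≤ ε / M ^ 2 := by
      rintro s t hst ⟨⟨x, hx, hx0, -⟩, -⟩ ⟨⟨x', hx', -, hx1⟩, hna⟩
      have hz : IsPrimalOptimal (Matrix.of A) (b + t • Matrix.col (Matrix.of A) i) c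
          (x + (t - s) • Pi.single i 1) := by
        have := IsPrimalOptimal.add_single hx hx0 (sub_nonneg.2 hst)
        simpa only [add_assoc, ← add_smul, add_sub_cancel] using this
      have hle : (x + (t - s) • (Pi.single i 1 : Fin n → ℝ)) i ≤ x' i := by
        by_contra! hlt
        exact hna ⟨x', _, hx', hz, hlt⟩
      simp only [Pi.add_apply, Pi.smul_apply, Pi.single_eq_same, smul_eq_mul, mul_one] at hle
      exact (by linarith : t - s ≤ x' i).trans hx1
    rw [edist_dist, Real.dist_eq]
    refine ENNReal.ofReal_le_ofReal ?_
    rcases le_total s t with h | h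
    · rw [abs_sub_comm, abs_of_nonneg (sub_nonneg.2 h)]
      exact key s t h hs ht
    · rw [abs_of_nonneg (sub_nonneg.2 h)]
      exact key t s h ht hs

/-- Without constraints, an optimal solution almost surely vanishes. -/
lemma gaussian_smallCoord_of_isEmpty (A : Fin 0 → Fin n → ℝ) (b₀ : Fin 0 → ℝ) (c₀ : Fin n → ℝ)
    {σ ε : ℝ} (hσ : 0 < σ) (i : Fin n) :
    (gaussianVec b₀ σ).prod (gaussianVec c₀ σ) {q | (A, q) ∈ smallCoord 0 ε i} = 0 := by
  refine measure_mono_null (fun q hq => ?_) (gaussian_ambiguousCoord A b₀ c₀ hσ i)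
  obtain ⟨x, hx, hx0, -⟩ := hq
  have := IsPrimalOptimal.add_single hx hx0 zero_le_one
  -- `Fin 0 → ℝ` has one point, so moving `b` changes nothing: `x` and `x + e_i` are optimal for the
  -- same program.
  rw [Subsingleton.elim (_ + _) q.1] at this
  exact ⟨x, _, hx, this, by simp⟩

lemma gaussianLP_le_of_forall (A₀ : Matrix (Fin m) (Fin n) ℝ) (b₀ : Fin m → ℝ) (c₀ : Fin n → ℝ)
    (σ : ℝ) {S : Set (Data m n)} (hS : MeasurableSet S) {K : ENNReal}
    (h : ∀ A, (gaussianVec b₀ σ).prod (gaussianVec c₀ σ) {q | (A, q) ∈ S} ≤ K) :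
    gaussianLP A₀ b₀ c₀ σ S ≤ K := by
  have : IsProbabilityMeasure (gaussianMat A₀ σ) := isProbabilityMeasure_gaussianMat A₀ σ
  rw [gaussianLP, Measure.prod_apply hS]
  exact (lintegral_mono h).trans (by simp)

/-! ### Duality -/

/-- The dual linear program, written as a primal one. -/
def dualData (p : Data m n) : Data n m := (fun i j => -p.1 j i, -p.2.2, -p.2.1)

lemma measurable_dualData : Measurable (dualData : Data m n → Data n m) := by
  unfold dualData
  refine Measurable.prodMk ?_ (by fun_prop)
  exact measurable_pi_lambda _ fun i => measurable_pi_lambda _ fun j => by fun_prop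

lemma of_dualData (p : Data m n) : Matrix.of (dualData p).1 = -(Matrix.of p.1)ᵀ := rfl

lemma opNorm_dualData (p : Data m n) :
    opNorm (Matrix.of (dualData p).1) = opNorm (Matrix.of p.1) := by
  rw [of_dualData, opNorm, opNorm, norm_neg, ← Matrix.conjTranspose_eq_transpose_of_trivial]
  exact Matrix.l2_opNorm_conjTranspose _

lemma opt_dualData {p : Data m n} {y : Fin m → ℝ}
    (hy : IsDualOptimal (Matrix.of p.1) p.2.1 p.2.2 y) : Opt (dualData p) y := by
  have hf : ∀ y, PrimalFeasible (Matrix.of (dualData p).1) (dualData p).2.1 y ↔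
      DualFeasible (Matrix.of p.1) p.2.2 y := fun y => by
    rw [PrimalFeasible, DualFeasible, of_dualData, Matrix.neg_mulVec, Matrix.mulVec_transpose]
    exact and_congr_left' neg_le_neg_iff
  refine ⟨(hf y).2 hy.1, fun y' hy' => ?_⟩
  have := hy.2 y' ((hf y').1 hy')
  simp only [dualData, neg_dotProduct, neg_le_neg_iff]
  rwa [dotProduct_comm, dotProduct_comm _ y']

/-- Swapping and negating `b` and `c` only recentres the Gaussians, and the fixed-`A` bounds hold
for any centres. -/
lemma gaussian_dualData (A : Fin m → Fin n → ℝ) (b₀ : Fin m → ℝ) (c₀ : Fin n → ℝ) (σ : ℝ)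
    {S : Set (Data n m)} (hS : MeasurableSet S) :
    (gaussianVec b₀ σ).prod (gaussianVec c₀ σ) {q | dualData (A, q) ∈ S} =
      (gaussianVec (-c₀) σ).prod (gaussianVec (-b₀) σ) {q | (fun i j => -A j i, q) ∈ S} := by
  have h := ((gaussianVec_map_neg c₀ σ).prod (gaussianVec_map_neg b₀ σ)).comp
    (Measure.measurePreserving_swap (μ := gaussianVec b₀ σ) (ν := gaussianVec c₀ σ))
  exact h.measure_preimage (s := Prod.mk (fun i j => -A j i) ⁻¹' S)
    (hS.preimage measurable_prodMk_left).nullMeasurableSet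

/-! ### From the minimum to single coordinates, and the union bound -/

lemma exists_of_iInf_le {k : ℕ} {x : Fin k → ℝ} {r : ℝ}
    (h : ⨅ i ∈ {i | 0 < x i}, (x i : EReal) ≤ (r : EReal)) : ∃ i, 0 < x i ∧ x i ≤ r := by
  by_contra! hlt
  by_cases hne : (Finset.univ.filter fun i => 0 < x i).Nonempty
  · obtain ⟨i, hi, hmin⟩ := Finset.exists_min_image _ x hne
    have : (x i : EReal) ≤ ⨅ i ∈ {i | 0 < x i}, (x i : EReal) :=
      le_iInf₂ fun j hj => EReal.coe_le_coe_iff.2 (hmin j (by simpa using hj))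
    exact absurd (EReal.coe_le_coe_iff.1 (this.trans h)) (not_le.2 (hlt i (by simpa using hi)))
  · have : (⊤ : EReal) ≤ ⨅ i ∈ {i | 0 < x i}, (x i : EReal) :=
      le_iInf₂ fun j hj => absurd ⟨j, by simpa using hj⟩ hne
    exact absurd (top_le_iff.1 (this.trans h)) (EReal.coe_ne_top r)

lemma threshold_le {ε N : ℝ} (hε : 0 ≤ ε) (hN : 0 ≤ N) {k : ℕ} (x : Fin k → ℝ) :
    ε / ((N + 2) ^ 2 * (euclNorm x + 1)) ≤ ε / (N + 2) ^ 2 := by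
  have : 0 ≤ euclNorm x := Real.sqrt_nonneg _
  gcongr
  exact le_mul_of_one_le_right (by positivity) (by linarith)

lemma isPrimalOptimal_xStar {A : Matrix (Fin m) (Fin n) ℝ} {b : Fin m → ℝ} {c : Fin n → ℝ}
    {i : Fin n} (h : 0 < xStar A b c i) : IsPrimalOptimal A b c (xStar A b c) := by
  by_cases hex : ∃ x, IsPrimalOptimal A b c x
  · rw [xStar, dif_pos hex]; exact hex.choose_spec
  · rw [xStar, dif_neg hex] at h; exact absurd h (lt_irrefl _)

lemma isDualOptimal_yStar {A : Matrix (Fin m) (Fin n) ℝ} {b : Fin m → ℝ} {c : Fin n → ℝ}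
    {j : Fin m} (h : 0 < yStar A b c j) : IsDualOptimal A b c (yStar A b c) := by
  by_cases hex : ∃ y, IsDualOptimal A b c y
  · rw [yStar, dif_pos hex]; exact hex.choose_spec
  · rw [yStar, dif_neg hex] at h; exact absurd h (lt_irrefl _)

lemma measure_iUnion_le_ofReal {Ω : Type*} [MeasurableSpace Ω] (μ : Measure Ω) {k : ℕ}
    (S : Fin k → Set Ω) {r : ℝ} (h : ∀ i, μ (S i) ≤ ENNReal.ofReal r) :
    μ (⋃ i, S i) ≤ ENNReal.ofReal (k * r) := by
  refine (measure_iUnion_fintype_le μ S).trans ((Finset.sum_le_sum fun i _ => h i).trans ?_)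
  simp [ENNReal.ofReal_mul]

end SmoothedLP

open SmoothedLP in
theorem lemma6p1 (m n : ℕ) (hmn : n ≤ m)
    (A₀ : Matrix (Fin m) (Fin n) ℝ) (b₀ : Fin m → ℝ) (c₀ : Fin n → ℝ)
    (hA₀ : SmoothedLP.opNorm A₀ ≤ 1) (hb₀ : SmoothedLP.euclNorm b₀ ≤ 1)
    (hc₀ : SmoothedLP.euclNorm c₀ ≤ 1)
    (σ : ℝ) (hσ : 0 < σ) (hσ1 : σ ^ 2 ≤ 1) (ε : ℝ) (hε : 0 ≤ ε) :
    SmoothedLP.gaussianLP A₀ b₀ c₀ σ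
        {p | let A : Matrix (Fin m) (Fin n) ℝ := Matrix.of p.1
             let b := p.2.1
             let c := p.2.2
             SmoothedLP.alphaP A b c ≤
                ((ε / ((SmoothedLP.opNorm A + 2) ^ 2 *
                  (SmoothedLP.euclNorm (SmoothedLP.xStar A b c) + 1)) : ℝ) : EReal) ∧
              SmoothedLP.FeasibleBounded A b c}
      ≤ ENNReal.ofReal (8 * ε * n * (m + 1) / σ ^ 2) ∧
    SmoothedLP.gaussianLP A₀ b₀ c₀ σ
        {p | let A : Matrix (Fin m) (Fin n) ℝ := Matrix.of p.1
             let b := p.2.1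
             let c := p.2.2
             SmoothedLP.alphaD A b c ≤
                ((ε / ((SmoothedLP.opNorm A + 2) ^ 2 *
                  (SmoothedLP.euclNorm (SmoothedLP.yStar A b c) + 1)) : ℝ) : EReal) ∧
              SmoothedLP.FeasibleBounded A b c}
      ≤ ENNReal.ofReal (8 * ε * n * (m + 1) / σ ^ 2) := by
  have hσ1' : σ ≤ 1 := (sq_le_one_iff₀ hσ.le).1 hσ1
  have hbound : ∀ k : ℝ, 0 ≤ k → k ≤ n * (m + 1) →
      k * (3 * ε / (2 * σ)) ≤ 8 * ε * n * (m + 1) / σ ^ 2 := by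
    intro k hk hkn
    -- Here `3 ≤ 8`, and `σ * σ ≤ 2 * σ` because `σ ≤ 1`.
    calc k * (3 * ε / (2 * σ)) ≤ (n * (m + 1)) * (8 * ε / (σ * σ)) := by
          gcongr
          · norm_num
          · linarith
      _ = _ := by ring
  constructor
  · have hsub : {p : Data m n | alphaP (Matrix.of p.1) p.2.1 p.2.2 ≤
          ((ε / ((opNorm (Matrix.of p.1) + 2) ^ 2 *
            (euclNorm (xStar (Matrix.of p.1) p.2.1 p.2.2) + 1)) : ℝ) : EReal) ∧
        FeasibleBounded (Matrix.of p.1) p.2.1 p.2.2} ⊆ ⋃ i, smallCoord m ε i := by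
      rintro p ⟨hp, -⟩
      obtain ⟨i, hi, hle⟩ := exists_of_iInf_le hp
      exact Set.mem_iUnion.2 ⟨i, _, isPrimalOptimal_xStar hi, hi,
        hle.trans (threshold_le hε (opNorm_nonneg _) _)⟩
    refine (measure_mono hsub).trans ((measure_iUnion_le_ofReal _ _ fun i =>
      gaussianLP_le_of_forall A₀ b₀ c₀ σ (measurableSet_smallCoord ε i) fun A =>
        gaussian_smallCoord_le A b₀ c₀ hσ hε i).trans (ENNReal.ofReal_le_ofReal ?_))
    refine hbound n (by positivity) (le_mul_of_one_le_right (by positivity) ?_)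
    linarith [(Nat.cast_nonneg m : (0 : ℝ) ≤ m)]
  · have hsub : {p : Data m n | alphaD (Matrix.of p.1) p.2.1 p.2.2 ≤
          ((ε / ((opNorm (Matrix.of p.1) + 2) ^ 2 *
            (euclNorm (yStar (Matrix.of p.1) p.2.1 p.2.2) + 1)) : ℝ) : EReal) ∧
        FeasibleBounded (Matrix.of p.1) p.2.1 p.2.2} ⊆
        ⋃ j, dualData ⁻¹' smallCoord n ε j := by
      rintro p ⟨hp, -⟩
      obtain ⟨j, hj, hle⟩ := exists_of_iInf_le hp
      refine Set.mem_iUnion.2 ⟨j, _, opt_dualData (isDualOptimal_yStar hj), hj, ?_⟩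
      rw [opNorm_dualData]
      exact hle.trans (threshold_le hε (opNorm_nonneg _) _)
    refine (measure_mono hsub).trans ?_
    -- The union over `m` dual coordinates needs `m ≤ n * (m + 1)`, which can fail for `n = 0`.
    -- There the claimed bound is zero, and the dual has no constraints.
    rcases Nat.eq_zero_or_pos n with rfl | hn
    · refine (measure_iUnion_null fun j => ?_).le.trans zero_le
      refine le_antisymm (gaussianLP_le_of_forall A₀ b₀ c₀ σ
        ((measurableSet_smallCoord ε j).preimage measurable_dualData) fun A => ?_) zero_le
      exact ((gaussian_dualData A b₀ c₀ σ (measurableSet_smallCoord ε j)).trans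
        (gaussian_smallCoord_of_isEmpty _ _ _ hσ j)).le
    · refine (measure_iUnion_le_ofReal _ _ fun j => gaussianLP_le_of_forall A₀ b₀ c₀ σ
        ((measurableSet_smallCoord ε j).preimage measurable_dualData) fun A =>
          (gaussian_dualData A b₀ c₀ σ (measurableSet_smallCoord ε j)).trans_le
            (gaussian_smallCoord_le _ _ _ hσ hε j)).trans (ENNReal.ofReal_le_ofReal ?_)
      refine hbound m (by positivity) ?_
      have : (1 : ℝ) ≤ n := by exact_mod_cast hn
      nlinarith [(Nat.cast_nonneg m : (0 : ℝ) ≤ m)]
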